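/- Let $\Gamma$ denote a finite simple graph of order $n$ with adjacency matrix $A$, let $J_n$ be the $n\times n$ all-ones matrix, and for an integer $d$ define polynomials by $G_{d,0}(x)=1$, $G_{d,1}(x)=x+1$ and $G_{d,m+1}(x)=xG_{d,m}(x)-(d-1)G_{d,m-1}(x)$ for $m\ge 1$. A $d$-regular graph $\Gamma$ of diameter $D$ has \emph{cyclic defect} if, for a suitable labelling of its vertices, $G_{d,D}(A)=J_n+A(C_n)$, where $A(C_n)$ is the adjacency matrix of the cycle of length $n$. A $d$-regular graph $\Gamma$ of girth $g$ has \emph{cyclic excess} if, for a suitable labelling of its vertices, $G_{d,\lfloor g/2\rfloor}(A)=J_n-A(C_n)$. \textbf{Theorem.} There is no regular graph of degree $d\ge 3$, diameter $4$ and cyclic defect, and there is no regular graph of odd degree $d\ge 3$, girth $9$ and cyclic excess. -/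

import Mathlib

open Polynomial

/-- The polynomials `G_{d,m}`: `G_{d,0} = 1`, `G_{d,1} = x + 1` and
`G_{d,m+2} = x G_{d,m+1} - (d - 1) G_{d,m}`. Their coefficients are integers. -/
noncomputable def pathPoly (d : ℕ) : ℕ → ℤ[X]
  | 0 => 1
  | 1 => X + 1
  | m + 2 => X * pathPoly d (m + 1) - C ((d : ℤ) - 1) * pathPoly d m

/-- `B` is, for a suitable labelling of the index set `V`, the adjacency matrix of the cycle `C_n`
with `n = |V|`. (Only used for graphs of degree at least 3, where `n ≥ 4`.) -/
def IsCycleMatrix {V : Type*} [Fintype V] (B : Matrix V V ℤ) : Prop :=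
  ∃ e : V ≃ Fin (Fintype.card V),
    B = ((SimpleGraph.cycleGraph (Fintype.card V)).adjMatrix ℤ).submatrix e e

/-- A `d`-regular graph, with adjacency matrix `A`, order `n` and diameter `D`, has cyclic defect:
`G_{d,D}(A) = J_n + B` where `B` is the adjacency matrix of an `n`-cycle. -/
def HasCyclicDefect {V : Type*} [Fintype V] [DecidableEq V] (Γ : SimpleGraph V)
    [DecidableRel Γ.Adj] (d : ℕ) : Prop :=
  Γ.IsRegularOfDegree d ∧ ∃ B : Matrix V V ℤ, IsCycleMatrix B ∧
    aeval (Γ.adjMatrix ℤ) (pathPoly d Γ.diam) = Matrix.of (fun _ _ => 1) + B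

/-- A `d`-regular graph, with adjacency matrix `A`, order `n` and girth `g`, has cyclic excess:
`G_{d,⌊g/2⌋}(A) = J_n - B` where `B` is the adjacency matrix of an `n`-cycle. -/
def HasCyclicExcess {V : Type*} [Fintype V] [DecidableEq V] (Γ : SimpleGraph V)
    [DecidableRel Γ.Adj] (d : ℕ) : Prop :=
  Γ.IsRegularOfDegree d ∧ ∃ B : Matrix V V ℤ, IsCycleMatrix B ∧
    aeval (Γ.adjMatrix ℤ) (pathPoly d (Γ.girth / 2)) = Matrix.of (fun _ _ => 1) - B

/-! In both cases the index is `4`, and with `q = d - 1` the polynomial is G(x) = x⁴ + x³ - 3qx² -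
2qx + q², so that G(A) = J + σB with σ = ±1. Row sums give n = d²(q² + 1) + 1 - 2σ, which is
divisible by 4 when d is odd, and is odd when d is even and σ = 1.

Odd d (`not_four_dvd_of_quartic_eq`): A commutes with J, hence with B, and preserves the integral
eigenvectors of B. As 4 ∣ n, B has the eigenvalue -2 with multiplicity one and 0 with multiplicity
two. On the first space A is an integer m with G(m) = -2σ; on the second it is an integral 2×2
matrix M with G(M) = 0. Either the characteristic polynomial of M divides G, which
`quartic_no_quadratic_factor` excludes, or M is a scalar root of G, which `quartic_root_and_pm_two`
excludes in the presence of m.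

Even d, σ = 1 (`CyclicDefectCount.even_card`): G(A) counts non-backtracking walks of length at most
4, so distinct vertices are joined by one such walk, or by two if consecutive on the n-cycle. Each
vertex has only two cycle neighbours, which rules out circuits of length 3 to 7 in Γ. Hence
consecutive vertices are antipodal on an octagon, and its perpendicular antipodal pair is again
consecutive. This pairs off the n edges of the cycle, so n is even, a contradiction. -/

/-! ### Arithmetic of the quartic. -/

/-- A factorization of `x⁴ + x³ - 3qx² - 2qx + q²` into two integral quadratics forces `q = 0`. -/
theorem quartic_no_quadratic_factor {q t D F : ℤ} (hq : q ≠ 0)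
    (hF : F = -3 * q + t * (1 + t) - D) (hu : -2 * q - D * (1 + t) + t * F = 0)
    (hw : q ^ 2 - D * F = 0) : False := by
  subst hF
  obtain ⟨s, hs⟩ : ∃ s, s = t * (t + 1) := ⟨_, rfl⟩
  have h1 : D * (1 + 2 * t) = t ^ 3 + t ^ 2 - 3 * q * t - 2 * q := by linarith
  -- The factors are x² - tx + D and x² + (1 + t)x + F. Eliminating `D` leaves a quadratic in `q`
  -- with quarter discriminant s²(4s + 1)(s + 1), where 4s + 1 = (2t + 1)². So s + 1 = t² + t + 1
  -- must be a square, which happens only for t = 0, -1.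
  have key : (5 * s + 1) * q ^ 2 - 2 * s * (3 * s + 1) * q + s ^ 3 = 0 := by
    subst hs
    linear_combination (-(1 + 2 * t) ^ 2) * hw
      - (-D * (1 + 2 * t) + (t ^ 2 + t - 3 * q) * (1 + 2 * t)
        - (t ^ 3 + t ^ 2 - 3 * q * t - 2 * q)) * h1
  have hs0 : s ≠ 0 := by
    rintro rfl
    apply hq
    have : q ^ 2 = 0 := by linarith
    exact pow_eq_zero_iff two_ne_zero |>.1 this
  have hsq : (s * (2 * t + 1)) ^ 2 * (t ^ 2 + t + 1) = ((5 * s + 1) * q - s * (3 * s + 1)) ^ 2 := by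
    have e1 : (2 * t + 1) ^ 2 = 4 * s + 1 := by subst hs; ring
    have e2 : t ^ 2 + t + 1 = s + 1 := by subst hs; ring
    rw [mul_pow, e1, e2]
    linear_combination (-(5 * s + 1)) * key
  have ha : s * (2 * t + 1) ≠ 0 := mul_ne_zero hs0 (by omega)
  obtain ⟨y, hy⟩ : s * (2 * t + 1) ∣ (5 * s + 1) * q - s * (3 * s + 1) :=
    (Int.pow_dvd_pow_iff two_ne_zero).1 ⟨_, hsq.symm⟩
  rw [hy, mul_pow _ y] at hsq
  have hy2 : t ^ 2 + t + 1 = y ^ 2 := mul_left_cancel₀ (pow_ne_zero 2 ha) hsq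
  rcases lt_trichotomy t (-1) with h | h | h
  · have h2 : |t + 1| < |y| := sq_lt_sq.1 (by nlinarith)
    have h3 : |y| < |t| := sq_lt_sq.1 (by nlinarith)
    rw [abs_of_neg (by omega : t + 1 < 0)] at h2
    rw [abs_of_neg (by omega : t < 0)] at h3
    omega
  · subst h; simp at hs; exact hs0 hs
  · rcases eq_or_lt_of_le (show 0 ≤ t by omega) with h0 | h0
    · subst h0; simp at hs; exact hs0 hs
    · have h2 : |t| < |y| := sq_lt_sq.1 (by nlinarith)
      have h3 : |y| < |t + 1| := sq_lt_sq.1 (by nlinarith)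
      rw [abs_of_pos h0] at h2
      rw [abs_of_pos (by omega : 0 < t + 1)] at h3
      omega

/-- The quartic `x⁴ + x³ - 3qx² - 2qx + q²`, with `q ≥ 2`, has no integral root at which some
other integer takes the value `±2`. -/
theorem quartic_root_and_pm_two {q l m t : ℤ} (hq : 2 ≤ q) (ht : t = 2 ∨ t = -2)
    (hl : l ^ 4 + l ^ 3 - 3 * q * l ^ 2 - 2 * q * l + q ^ 2 = 0)
    (hm : m ^ 4 + m ^ 3 - 3 * q * m ^ 2 - 2 * q * m + q ^ 2 = t) : False := by
  obtain ⟨r, rfl⟩ : ∃ r, m = l + r := ⟨m - l, by ring⟩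
  have hd : r ∣ 2 := by
    have : r ∣ t := ⟨(l + r) ^ 3 + (l + r) ^ 2 * l + (l + r) * l ^ 2 + l ^ 3 + (l + r) ^ 2
      + (l + r) * l + l ^ 2 - 3 * q * (2 * l + r) - 2 * q, by linear_combination hl - hm⟩
    rcases ht with rfl | rfl
    · exact this
    · exact (dvd_neg.1 this)
  have hr : r = 1 ∨ r = -1 ∨ r = 2 ∨ r = -2 := by
    have h1 := Int.le_of_dvd (by norm_num) hd
    have h2 := Int.le_of_dvd (by norm_num) (neg_dvd.2 hd)
    have h3 : r ≠ 0 := by rintro rfl; simp at hd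
    omega
  have h : ((l + r) ^ 4 + (l + r) ^ 3 - l ^ 4 - l ^ 3 - t) = q * (6 * l * r + 3 * r ^ 2 + 2 * r) := by
    linear_combination hm - hl
  -- Elimination of `q` between `h` and `hl`: a sextic in `l` for each of the finitely many `r`,
  -- `t`.
  have hR : ((l + r) ^ 4 + (l + r) ^ 3 - l ^ 4 - l ^ 3 - t) ^ 2
      - (3 * l ^ 2 + 2 * l) * ((l + r) ^ 4 + (l + r) ^ 3 - l ^ 4 - l ^ 3 - t)
        * (6 * l * r + 3 * r ^ 2 + 2 * r)
      + (l ^ 4 + l ^ 3) * (6 * l * r + 3 * r ^ 2 + 2 * r) ^ 2 = 0 := by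
    rw [h]
    linear_combination (6 * l * r + 3 * r ^ 2 + 2 * r) ^ 2 * hl
  have hlow : -9 ≤ l := by
    by_contra hc
    obtain ⟨k, _⟩ := Int.eq_ofNat_of_zero_le (show 0 ≤ -10 - l by omega)
    have hk := pow_nonneg (Int.natCast_nonneg k)
    obtain rfl : l = -10 - k := by omega
    rcases hr with rfl | rfl | rfl | rfl <;> rcases ht with rfl | rfl <;> ring_nf at hR <;>
      linarith [hk 1, hk 2, hk 3, hk 4, hk 5, hk 6]
  have hupp : l ≤ 9 := by
    by_contra hc
    obtain ⟨k, _⟩ := Int.eq_ofNat_of_zero_le (show 0 ≤ l - 10 by omega)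
    have hk := pow_nonneg (Int.natCast_nonneg k)
    obtain rfl : l = 10 + k := by omega
    rcases hr with rfl | rfl | rfl | rfl <;> rcases ht with rfl | rfl <;> ring_nf at hR <;>
      linarith [hk 1, hk 2, hk 3, hk 4, hk 5, hk 6]
  -- Any `l` surviving `hR` is excluded by `h`, which is linear in `q` once `l` is a numeral,
  -- together with `hq`.
  clear hm hl hd
  rcases hr with rfl | rfl | rfl | rfl <;> rcases ht with rfl | rfl <;>
    interval_cases l <;> norm_num at hR <;> omega

/-! ### Integral eigenvectors of the cycle. -/

open Matrix in
/-- A matrix of a cycle of length at least `3`, in terms of a labelling by `ZMod n`. -/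
theorem IsCycleMatrix.exists_equiv_zmod {V : Type*} [Fintype V] {B : Matrix V V ℤ}
    (hB : IsCycleMatrix B) (h : 3 ≤ Fintype.card V) :
    ∃ p : ZMod (Fintype.card V) ≃ V,
      ∀ i j, B (p i) (p j) = if i - j = 1 ∨ j - i = 1 then 1 else 0 := by
  unfold IsCycleMatrix at hB
  obtain ⟨k, hk⟩ : ∃ k, Fintype.card V = k + 2 := ⟨Fintype.card V - 2, by omega⟩
  rw [hk] at hB ⊢
  obtain ⟨e, rfl⟩ := hB
  have h (i j : Fin (k + 2)) : ((SimpleGraph.cycleGraph (k + 2)).adjMatrix ℤ).submatrix e e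
      (e.symm i) (e.symm j) = if i - j = 1 ∨ j - i = 1 then 1 else 0 := by
    simp [SimpleGraph.adjMatrix_apply, SimpleGraph.cycleGraph_adj]
  exact ⟨e.symm, fun i j => (h i j).trans (by congr)⟩

section Cycle

variable {V : Type*} [Fintype V] {n : ℕ} {B : Matrix V V ℤ} {p : ZMod n ≃ V}

open Matrix

theorem cycle_mulVec (hn : 3 ≤ n)
    (hB : ∀ i j, B (p i) (p j) = if i - j = 1 ∨ j - i = 1 then 1 else 0)
    (y : V → ℤ) (i : ZMod n) : (B *ᵥ y) (p i) = y (p (i + 1)) + y (p (i - 1)) := by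
  have : NeZero n := ⟨by omega⟩
  have h2 : (2 : ZMod n) ≠ 0 := by
    intro h
    have : ((2 : ℕ) : ZMod n) = 0 := by exact_mod_cast h
    rw [ZMod.natCast_eq_zero_iff] at this
    have := Nat.le_of_dvd (by norm_num) this
    omega
  rw [mulVec, dotProduct, ← p.sum_comp]
  have : ∀ j, B (p i) (p j) * y (p j)
      = (if j = i + 1 then y (p j) else 0) + (if j = i - 1 then y (p j) else 0) := by
    intro j
    rw [hB]
    have e1 : i - j = 1 ↔ j = i - 1 := by constructor <;> intro h <;> linear_combination -h
    have e2 : j - i = 1 ↔ j = i + 1 := by constructor <;> intro h <;> linear_combination h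
    simp only [e1, e2]
    by_cases ha : j = i + 1
    · have : j ≠ i - 1 := fun hb => h2 (by linear_combination hb - ha)
      simp [ha] at this ⊢
      simp [this]
    · by_cases hb : j = i - 1 <;> simp [ha, hb] at *
      simp [ha]
  simp [this, Finset.sum_add_distrib]

theorem cycle_mulVec_sum_eq_zero (hn : 3 ≤ n)
    (hB : ∀ i j, B (p i) (p j) = if i - j = 1 ∨ j - i = 1 then 1 else 0)
    {y : V → ℤ} {κ : ℤ} (hκ : κ ≠ 2) (hy : B *ᵥ y = κ • y) : ∑ v, y v = 0 := by
  have : NeZero n := ⟨by omega⟩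
  have h1 : ∑ v, (B *ᵥ y) v = 2 * ∑ v, y v := by
    rw [← p.sum_comp, ← p.sum_comp y]
    simp only [cycle_mulVec hn hB, Finset.sum_add_distrib]
    have e1 := Equiv.sum_comp (Equiv.addRight (1 : ZMod n)) (fun i => y (p i))
    have e2 := Equiv.sum_comp (Equiv.subRight (1 : ZMod n)) (fun i => y (p i))
    simp only [Equiv.coe_addRight, Equiv.subRight_apply] at e1 e2
    rw [e1, e2]
    ring
  rw [hy] at h1
  simp only [Pi.smul_apply, smul_eq_mul, ← Finset.mul_sum] at h1
  have : (κ - 2) * ∑ v, y v = 0 := by linarith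
  exact (mul_eq_zero.1 this).resolve_left (sub_ne_zero.2 hκ)

theorem cycle_step (hn : 3 ≤ n)
    (hB : ∀ i j, B (p i) (p j) = if i - j = 1 ∨ j - i = 1 then 1 else 0)
    {y : V → ℤ} {κ : ℤ} (hy : B *ᵥ y = κ • y) (k : ℕ) :
    y (p ((k + 1 : ℕ) + 1 : ZMod n)) = κ * y (p (k + 1 : ℕ)) - y (p k) := by
  have := cycle_mulVec hn hB y ((k + 1 : ℕ) : ZMod n)
  rw [hy] at this
  simp only [Pi.smul_apply, smul_eq_mul] at this
  rw [show ((k + 1 : ℕ) : ZMod n) - 1 = k by push_cast; ring] at this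
  linarith

theorem cycle_eigenvector_eq_zero (hn : 3 ≤ n)
    (hB : ∀ i j, B (p i) (p j) = if i - j = 1 ∨ j - i = 1 then 1 else 0)
    {y : V → ℤ} {κ : ℤ} (hy : B *ᵥ y = κ • y) (h0 : y (p 0) = 0) (h1 : y (p 1) = 0) : y = 0 := by
  have : NeZero n := ⟨by omega⟩
  have key : ∀ k : ℕ, y (p k) = 0 ∧ y (p (k + 1 : ℕ)) = 0 := by
    intro k
    induction k with
    | zero => simpa using ⟨h0, h1⟩
    | succ k ih =>
      refine ⟨ih.2, ?_⟩
      have := cycle_step hn hB hy k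
      push_cast at this ih ⊢
      rw [this, ih.1, ih.2]
      simp
  funext v
  obtain ⟨i, rfl⟩ := p.surjective v
  have := (key i.val).1
  rwa [ZMod.natCast_zmod_val] at this

/-- The recurrence has the double root -1, so a solution vanishing at 0 grows linearly; closing up
after `n` steps forces n · y(1) = 0. -/
theorem cycle_neg_two_eigenvector_eq_zero (hn : 3 ≤ n) (he : Even n)
    (hB : ∀ i j, B (p i) (p j) = if i - j = 1 ∨ j - i = 1 then 1 else 0)
    {y : V → ℤ} (hy : B *ᵥ y = (-2 : ℤ) • y) (h0 : y (p 0) = 0) : y = 0 := by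
  refine cycle_eigenvector_eq_zero hn hB hy h0 ?_
  have key : ∀ k : ℕ, y (p k) = - (-1) ^ k * k * y (p 1) ∧
      y (p (k + 1 : ℕ)) = (-1) ^ k * (k + 1) * y (p 1) := by
    intro k
    induction k with
    | zero => simp [h0]
    | succ k ih =>
      have := cycle_step hn hB hy k
      refine ⟨by rw [ih.2]; push_cast; ring, ?_⟩
      rw [ih.1, ih.2] at this
      push_cast at this ⊢
      rw [this]
      ring
  have := (key n).1
  rw [ZMod.natCast_self, h0, he.neg_one_pow] at this
  have hn' : (n : ℤ) ≠ 0 := by exact_mod_cast (by omega : n ≠ 0)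
  have h3 : (n : ℤ) * y (p 1) = 0 := by linarith
  exact (mul_eq_zero.1 h3).resolve_left hn'

/-- Pulling back a function on `ZMod 4` gives a vector on the cycle. -/
theorem cycle_mulVec_pullback (hn : 3 ≤ n) (h4 : 4 ∣ n)
    (hB : ∀ i j, B (p i) (p j) = if i - j = 1 ∨ j - i = 1 then 1 else 0)
    (φ : ZMod 4 → ℤ) (κ : ℤ) (hφ : ∀ i, φ (i + 1) + φ (i - 1) = κ * φ i) :
    B *ᵥ (fun v => φ (ZMod.castHom h4 (ZMod 4) (p.symm v)))
      = κ • (fun v => φ (ZMod.castHom h4 (ZMod 4) (p.symm v))) := by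
  funext v
  obtain ⟨i, rfl⟩ := p.surjective v
  rw [cycle_mulVec hn hB]
  simp only [Equiv.symm_apply_apply, map_add, map_sub, map_one, hφ, Pi.smul_apply, smul_eq_mul]

/-- Vectors of sum zero are killed by J, so the quartic in A acts on them through B alone. -/
theorem quartic_mulVec [DecidableEq V] {A : Matrix V V ℤ} {q σ : ℤ}
    (hG : A ^ 4 + A ^ 3 - (3 * q) • A ^ 2 - (2 * q) • A + (q ^ 2) • (1 : Matrix V V ℤ)
      = Matrix.of (fun _ _ => 1) + σ • B) {y : V → ℤ} {κ : ℤ} (hs : ∑ v, y v = 0)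
    (hy : B *ᵥ y = κ • y) :
    A *ᵥ A *ᵥ A *ᵥ A *ᵥ y + A *ᵥ A *ᵥ A *ᵥ y - (3 * q) • A *ᵥ A *ᵥ y - (2 * q) • A *ᵥ y
      + (q ^ 2) • y = (σ * κ) • y := by
  have hJ : (Matrix.of (fun _ _ => 1) : Matrix V V ℤ) *ᵥ y = 0 := by
    funext v
    simp [mulVec, dotProduct, hs]
  have := congrArg (· *ᵥ y) hG
  simp only [add_mulVec, sub_mulVec, smul_mulVec, hJ, hy, one_mulVec, zero_add, smul_smul] at this
  rw [← this]
  simp only [mulVec_mulVec, pow_succ', pow_zero, mul_one]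

/-- If `A` commutes with the cycle matrix `B` and `A⁴ + A³ - 3qA² - 2qA + q² = J ± B`,
then the length of the cycle is not divisible by `4`. -/
theorem not_four_dvd_of_quartic_eq [DecidableEq V] {A : Matrix V V ℤ} {q σ : ℤ} (hq : 2 ≤ q)
    (hσ : σ = 1 ∨ σ = -1) (hn : 3 ≤ n)
    (hB : ∀ i j, B (p i) (p j) = if i - j = 1 ∨ j - i = 1 then 1 else 0)
    (hAB : A * B = B * A)
    (hG : A ^ 4 + A ^ 3 - (3 * q) • A ^ 2 - (2 * q) • A + (q ^ 2) • (1 : Matrix V V ℤ)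
      = Matrix.of (fun _ _ => 1) + σ • B) : ¬ 4 ∣ n := by
  intro h4
  have he : Even n := even_iff_two_dvd.2 (dvd_trans (by norm_num) h4)
  have hA : ∀ {y : V → ℤ} {κ : ℤ}, B *ᵥ y = κ • y → B *ᵥ (A *ᵥ y) = κ • (A *ᵥ y) := by
    intro y κ h
    rw [mulVec_mulVec, ← hAB, ← mulVec_mulVec, h, mulVec_smul]
  have hsub : ∀ {y z : V → ℤ} {κ : ℤ}, B *ᵥ y = κ • y → B *ᵥ z = κ • z →
      B *ᵥ (y - z) = κ • (y - z) := by
    intro y z κ h1 h2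
    rw [mulVec_sub, h1, h2, smul_sub]
  have hadd : ∀ {y z : V → ℤ} {κ : ℤ}, B *ᵥ y = κ • y → B *ᵥ z = κ • z →
      B *ᵥ (y + z) = κ • (y + z) := by
    intro y z κ h1 h2
    rw [mulVec_add, h1, h2, smul_add]
  have hsmul : ∀ {y : V → ℤ} {κ : ℤ} (c : ℤ), B *ᵥ y = κ • y → B *ᵥ (c • y) = κ • (c • y) := by
    intro y κ c h1
    rw [mulVec_smul, h1, smul_comm]
  -- the eigenvalue `-2`
  obtain ⟨x, hx, hx0⟩ : ∃ x : V → ℤ, B *ᵥ x = (-2 : ℤ) • x ∧ x (p 0) = 1 :=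
    ⟨_, cycle_mulVec_pullback hn h4 hB (![1, -1, 1, -1] : Fin 4 → ℤ) (-2) (by decide), by simp⟩
  obtain ⟨m, hm⟩ : ∃ m : ℤ, A *ᵥ x = m • x := by
    refine ⟨(A *ᵥ x) (p 0), sub_eq_zero.1 ?_⟩
    exact cycle_neg_two_eigenvector_eq_zero hn he hB (hsub (hA hx) (hsmul _ hx)) (by simp [hx0])
  have hmG := congrFun (quartic_mulVec hG (cycle_mulVec_sum_eq_zero hn hB (by norm_num) hx) hx) (p 0)
  simp only [hm, mulVec_smul, Pi.add_apply, Pi.sub_apply, Pi.smul_apply, smul_eq_mul, hx0] at hmG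
  -- the eigenvalue `0`
  obtain ⟨f, hf, hf0, hf1⟩ : ∃ f : V → ℤ, B *ᵥ f = (0 : ℤ) • f ∧ f (p 0) = 1 ∧ f (p 1) = 0 :=
    ⟨_, cycle_mulVec_pullback hn h4 hB (![1, 0, -1, 0] : Fin 4 → ℤ) 0 (by decide), by simp,
      by simp only [Equiv.symm_apply_apply, map_one]; rfl⟩
  obtain ⟨g, hg, hg0, hg1⟩ : ∃ g : V → ℤ, B *ᵥ g = (0 : ℤ) • g ∧ g (p 0) = 0 ∧ g (p 1) = 1 :=
    ⟨_, cycle_mulVec_pullback hn h4 hB (![0, 1, 0, -1] : Fin 4 → ℤ) 0 (by decide), by simp,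
      by simp only [Equiv.symm_apply_apply, map_one]; rfl⟩
  -- `f` and `g` are dual to evaluation at `p 0` and `p 1`, so A acts on the kernel of B by an
  -- integral matrix.
  have hspan : ∀ y : V → ℤ, B *ᵥ y = (0 : ℤ) • y → y = y (p 0) • f + y (p 1) • g := by
    intro y hy
    refine sub_eq_zero.1 (cycle_eigenvector_eq_zero hn hB
      (hsub hy (hadd (hsmul _ hf) (hsmul _ hg))) ?_ ?_) <;> simp [hf0, hf1, hg0, hg1]
  obtain ⟨a, b, hAf⟩ : ∃ a b : ℤ, A *ᵥ f = a • f + b • g := ⟨_, _, hspan _ (hA hf)⟩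
  obtain ⟨c, e, hAg⟩ : ∃ c e : ℤ, A *ᵥ g = c • f + e • g := ⟨_, _, hspan _ (hA hg)⟩
  have hfG := quartic_mulVec hG (cycle_mulVec_sum_eq_zero hn hB (by norm_num) hf) hf
  have hgG := quartic_mulVec hG (cycle_mulVec_sum_eq_zero hn hB (by norm_num) hg) hg
  have hf00 := congrFun hfG (p 0)
  have hf11 := congrFun hfG (p 1)
  have hg00 := congrFun hgG (p 0)
  have hg11 := congrFun hgG (p 1)
  simp only [hAf, hAg, mulVec_add, mulVec_smul, Pi.add_apply, Pi.sub_apply, Pi.smul_apply,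
    smul_eq_mul, hf0, hf1, hg0, hg1] at hf00 hf11 hg00 hg11
  clear hfG hgG
  -- By Cayley–Hamilton the quartic at this matrix equals u · M + w, where ux + w is its remainder
  -- modulo x² - tx + D.
  obtain ⟨t, ht⟩ : ∃ t, t = a + e := ⟨_, rfl⟩
  obtain ⟨D, hD⟩ : ∃ D, D = a * e - b * c := ⟨_, rfl⟩
  obtain ⟨F, hF⟩ : ∃ F, F = -3 * q + t * (1 + t) - D := ⟨_, rfl⟩
  obtain ⟨u, hu⟩ : ∃ u, u = -2 * q - D * (1 + t) + t * F := ⟨_, rfl⟩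
  obtain ⟨w, hw⟩ : ∃ w, w = q ^ 2 - D * F := ⟨_, rfl⟩
  have h1 : u * b = 0 := by rw [hu, hF, hD, ht]; linear_combination hf11
  have h2 : u * c = 0 := by rw [hu, hF, hD, ht]; linear_combination hg00
  have h3 : u * a + w = 0 := by rw [hw, hu, hF, hD, ht]; linear_combination hf00
  have h4 : u * e + w = 0 := by rw [hw, hu, hF, hD, ht]; linear_combination hg11
  by_cases hu0 : u = 0
  · have hw0 : w = 0 := by rw [hu0] at h3; linarith
    exact quartic_no_quadratic_factor (by omega) hF (hu ▸ hu0) (hw ▸ hw0)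
  · have hb := (mul_eq_zero.1 h1).resolve_left hu0
    subst hb
    refine quartic_root_and_pm_two hq (l := a) (m := m) (t := σ * -2) ?_ (by linear_combination hf00)
      (by linear_combination hmG)
    rcases hσ with rfl | rfl <;> simp

end Cycle

/-! ### Short circuits in a graph of cyclic defect. -/

namespace SimpleGraph

variable {V : Type*}

/-- `u ≠ v` have a common neighbour. -/
def HasMidpoint (Γ : SimpleGraph V) (u v : V) : Prop :=
  u ≠ v ∧ ∃ w, Γ.Adj u w ∧ Γ.Adj w v

instance [Fintype V] [DecidableEq V] (Γ : SimpleGraph V) [DecidableRel Γ.Adj] :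
    DecidableRel Γ.HasMidpoint := fun u v => by unfold HasMidpoint; infer_instance

theorem HasMidpoint.symm {Γ : SimpleGraph V} {u v : V} (h : Γ.HasMidpoint u v) :
    Γ.HasMidpoint v u := by
  obtain ⟨h, w, h1, h2⟩ := h
  exact ⟨h.symm, w, h2.symm, h1.symm⟩

theorem HasMidpoint.intro {Γ : SimpleGraph V} {u v : V} (w : V) (h : u ≠ v) (h1 : Γ.Adj u w)
    (h2 : Γ.Adj w v) : Γ.HasMidpoint u v := ⟨h, w, h1, h2⟩

/-- `v` and `u` are consecutive on the cycle with successor map `s`. -/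
def SuccAdj (s : V → V) (u v : V) : Prop := v = s u ∨ u = s v

instance [DecidableEq V] (s : V → V) : DecidableRel (SuccAdj s) :=
  fun u v => by unfold SuccAdj; infer_instance

theorem SuccAdj.symm {s : V → V} {u v : V} (h : SuccAdj s u v) : SuccAdj s v u := Or.symm h

variable [Fintype V] [DecidableEq V] {Γ : SimpleGraph V} [DecidableRel Γ.Adj]

variable (Γ) in
/-- The vertices of `Γ` lie on a cycle with successor map `s`, `Γ` has no cycles of
length `3` or `4`, and the number of non-backtracking walks of length at most `4` between two
distinct vertices is `2` if they are consecutive on the cycle, and `1` otherwise. -/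
structure CyclicDefectCount (s : V → V) (d : ℕ) : Prop where
  two_lt : 2 < d
  regular : Γ.IsRegularOfDegree d
  card : 7 < Fintype.card V
  inj : Function.Injective s
  succ_ne : ∀ u, s u ≠ u
  succ_succ_ne : ∀ u, s (s u) ≠ u
  transitive : ∀ S : Set V, S.Nonempty → (∀ u ∈ S, s u ∈ S) → S = Set.univ
  no_triangle : ∀ ⦃u v w⦄, Γ.Adj u v → Γ.Adj v w → ¬ Γ.Adj u w
  no_square : ∀ ⦃u v w x⦄, u ≠ v → Γ.Adj u w → Γ.Adj w v → Γ.Adj u x → Γ.Adj x v → w = x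
  -- With T the matrix of `HasMidpoint`, the products T² and AT also count backtracking walks: off
  -- the diagonal, d - 2 for each pair with a midpoint and d - 1 for each edge. Removing these and
  -- adding the walks of length 1 and 2 gives the coefficients d - 3 and 2 - d.
  count : ∀ u v, u ≠ v →
    ((Finset.univ.filter fun b => Γ.HasMidpoint u b ∧ Γ.HasMidpoint b v).card : ℤ)
      + (Finset.univ.filter fun w => Γ.Adj u w ∧ Γ.HasMidpoint w v).card
      + (if Γ.Adj u v then 2 - (d : ℤ) else 0)
    = 1 + (if SuccAdj s u v then 1 else 0) + (if Γ.HasMidpoint u v then (d : ℤ) - 3 else 0)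

namespace CyclicDefectCount

variable {s : V → V} {d : ℕ} (h : Γ.CyclicDefectCount s d)

include h

theorem succAdj_ne {u v : V} (huv : SuccAdj s u v) : u ≠ v := by
  rintro rfl
  rcases huv with h1 | h1 <;> exact h.succ_ne _ h1.symm

theorem succAdj_three {u a b c : V} (ha : SuccAdj s u a) (hb : SuccAdj s u b) (hc : SuccAdj s u c)
    (hab : a ≠ b) (hac : a ≠ c) (hbc : b ≠ c) : False := by
  have := h.inj
  unfold SuccAdj at *
  unfold Function.Injective at *
  grind

theorem not_adj_of_hasMidpoint {u v : V} (huv : Γ.HasMidpoint u v) : ¬ Γ.Adj u v := by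
  obtain ⟨_, w, h1, h2⟩ := huv
  exact h.no_triangle h1 h2

theorem card_neighbors (x : V) : (Finset.univ.filter fun b => Γ.Adj x b).card = d := by
  rw [← Γ.neighborFinset_eq_filter]
  exact h.regular x

theorem card_neighbors_ne {u v : V} (huv : Γ.Adj u v) :
    (Finset.univ.filter fun w => Γ.Adj u w ∧ w ≠ v).card = d - 1 := by
  have : (Finset.univ.filter fun w => Γ.Adj u w ∧ w ≠ v)
      = (Finset.univ.filter fun b => Γ.Adj u b).erase v := by
    ext w; simp [and_comm]
  rw [this, Finset.card_erase_of_mem (by simpa using huv), h.card_neighbors]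

theorem card_neighbors_ne_ne {x u v : V} (huv : u ≠ v) (hu : Γ.Adj x u) (hv : Γ.Adj x v) :
    (Finset.univ.filter fun w => Γ.Adj x w ∧ w ≠ u ∧ w ≠ v).card = d - 2 := by
  have : (Finset.univ.filter fun w => Γ.Adj x w ∧ w ≠ u ∧ w ≠ v)
      = ((Finset.univ.filter fun b => Γ.Adj x b).erase u).erase v := by
    ext w; simp only [Finset.mem_filter, Finset.mem_univ, Finset.mem_erase]; tauto
  rw [this, Finset.card_erase_of_mem (by simpa using ⟨huv.symm, hv⟩),
    Finset.card_erase_of_mem (by simpa using hu), h.card_neighbors]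
  omega

theorem card_step_of_adj {u v : V} (huv : Γ.Adj u v) :
    (Finset.univ.filter fun w => Γ.Adj u w ∧ Γ.HasMidpoint w v).card = d - 1 := by
  rw [← h.card_neighbors_ne huv]
  congr 1
  ext w
  simp only [Finset.mem_filter, Finset.mem_univ, true_and, and_congr_right_iff]
  exact fun hw => ⟨fun h1 => h1.1, fun h1 => .intro u h1 hw.symm huv⟩

theorem card_middle_of_hasMidpoint {u v : V} (huv : Γ.HasMidpoint u v) :
    d - 2 ≤ (Finset.univ.filter fun b => Γ.HasMidpoint u b ∧ Γ.HasMidpoint b v).card := by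
  obtain ⟨hne, x, hu, hv⟩ := huv
  rw [← h.card_neighbors_ne_ne hne hu.symm hv]
  apply Finset.card_le_card
  intro w
  simp only [Finset.mem_filter, Finset.mem_univ, true_and]
  rintro ⟨h1, h2, h3⟩
  exact ⟨.intro x h2.symm hu h1, .intro x h3 h1.symm hv⟩

theorem succAdj_of_adj {u v b : V} (huv : Γ.Adj u v) (hb : Γ.HasMidpoint u b)
    (hb' : Γ.HasMidpoint b v) : SuccAdj s u v := by
  have h1 := h.count u v huv.ne
  rw [h.card_step_of_adj huv, if_pos huv, if_neg (fun hm => h.not_adj_of_hasMidpoint hm huv)] at h1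
  have h2 : 0 < (Finset.univ.filter fun b => Γ.HasMidpoint u b ∧ Γ.HasMidpoint b v).card :=
    Finset.card_pos.2 ⟨b, by simp [hb, hb']⟩
  have := h.two_lt
  by_contra hc
  rw [if_neg hc] at h1
  omega

theorem succAdj_of_hasMidpoint_of_step {u v w : V} (huv : Γ.HasMidpoint u v) (hw : Γ.Adj u w)
    (hw' : Γ.HasMidpoint w v) : SuccAdj s u v := by
  have h1 := h.count u v huv.1
  rw [if_pos huv, if_neg (h.not_adj_of_hasMidpoint huv)] at h1
  have h2 := h.card_middle_of_hasMidpoint huv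
  have h3 : 0 < (Finset.univ.filter fun w => Γ.Adj u w ∧ Γ.HasMidpoint w v).card :=
    Finset.card_pos.2 ⟨w, by simp [hw, hw']⟩
  have := h.two_lt
  by_contra hc
  rw [if_neg hc] at h1
  omega

theorem succAdj_of_hasMidpoint_of_middle {u v x b : V} (huv : u ≠ v) (hu : Γ.Adj u x)
    (hv : Γ.Adj x v) (hb : Γ.HasMidpoint u b) (hb' : Γ.HasMidpoint b v) (hxb : ¬ Γ.Adj x b) :
    SuccAdj s u v := by
  have hm : Γ.HasMidpoint u v := .intro x huv hu hv
  have h1 := h.count u v huv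
  rw [if_pos hm, if_neg (h.not_adj_of_hasMidpoint hm)] at h1
  have h2 : d - 2 + 1 ≤
      (Finset.univ.filter fun b => Γ.HasMidpoint u b ∧ Γ.HasMidpoint b v).card := by
    rw [← h.card_neighbors_ne_ne huv hu.symm hv, Nat.add_one_le_iff]
    apply Finset.card_lt_card
    refine (Finset.ssubset_iff_of_subset ?_).2 ⟨b, by simp [hb, hb'], by simp [hxb]⟩
    intro w
    simp only [Finset.mem_filter, Finset.mem_univ, true_and]
    rintro ⟨h1, h2, h3⟩
    exact ⟨.intro x h2.symm hu h1, .intro x h3 h1.symm hv⟩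
  have := h.two_lt
  by_contra hc
  rw [if_neg hc] at h1
  omega

theorem count_of_far {u v : V} (huv : u ≠ v) (ha : ¬ Γ.Adj u v) (hm : ¬ Γ.HasMidpoint u v) :
    (Finset.univ.filter fun b => Γ.HasMidpoint u b ∧ Γ.HasMidpoint b v).card
      + (Finset.univ.filter fun w => Γ.Adj u w ∧ Γ.HasMidpoint w v).card
    = 1 + (if SuccAdj s u v then 1 else 0) := by
  have h1 := h.count u v huv
  rw [if_neg hm, if_neg ha] at h1
  split_ifs at h1 ⊢ <;> omega

theorem succAdj_of_two_le {u v : V} (huv : u ≠ v) (ha : ¬ Γ.Adj u v) (hm : ¬ Γ.HasMidpoint u v)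
    (h2 : 2 ≤ (Finset.univ.filter fun b => Γ.HasMidpoint u b ∧ Γ.HasMidpoint b v).card
      + (Finset.univ.filter fun w => Γ.Adj u w ∧ Γ.HasMidpoint w v).card) : SuccAdj s u v := by
  have h1 := h.count_of_far huv ha hm
  by_contra hc
  rw [if_neg hc] at h1
  omega

/-- Any two vertices of a pentagon are joined by both of its arcs, so they would be consecutive; `u`
would have too many cycle neighbours. -/
theorem no_pentagon {u v b : V} (huv : Γ.Adj u v) (hu : Γ.HasMidpoint u b)
    (hv : Γ.HasMidpoint b v) : False := by
  obtain ⟨hub, p, hup, hpb⟩ := id hu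
  obtain ⟨hbv, r, hbr, hrv⟩ := id hv
  have hur : u ≠ r := by
    rintro rfl
    exact h.not_adj_of_hasMidpoint hu hbr.symm
  have hpr : p ≠ r := by
    rintro rfl
    exact h.no_triangle hup hrv huv
  exact h.succAdj_three (h.succAdj_of_adj huv hu hv)
    (h.succAdj_of_hasMidpoint_of_step hu huv hv.symm)
    (h.succAdj_of_hasMidpoint_of_step (.intro v hur huv hrv.symm) hup (.intro b hpr hpb hbr))
    hbv.symm hrv.ne.symm hbr.ne

theorem not_adj_of_succAdj {u v : V} (huv : SuccAdj s u v) : ¬ Γ.Adj u v := by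
  intro ha
  have h1 := h.count u v ha.ne
  rw [h.card_step_of_adj ha, if_pos ha, if_neg (fun hm => h.not_adj_of_hasMidpoint hm ha),
    if_pos huv] at h1
  have := h.two_lt
  obtain ⟨b, hb⟩ := Finset.card_pos.1
    (show 0 < (Finset.univ.filter fun b => Γ.HasMidpoint u b ∧ Γ.HasMidpoint b v).card by omega)
  simp only [Finset.mem_filter, Finset.mem_univ, true_and] at hb
  exact h.no_pentagon ha hb.1 hb.2

theorem no_hexagon {u v x b : V} (huv : u ≠ v) (hu : Γ.Adj u x) (hv : Γ.Adj x v)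
    (hub : Γ.HasMidpoint u b) (hbv : Γ.HasMidpoint b v) : Γ.Adj x b := by
  by_contra hxb
  have hm : Γ.HasMidpoint u v := .intro x huv hu hv
  obtain ⟨hne, p, hup, hpb⟩ := id hub
  obtain ⟨hne', r, hbr, hrv⟩ := id hbv
  have key : ∀ y, Γ.Adj u y → ¬ Γ.Adj y v ∨ y = x := fun y h1 => by
    by_cases h2 : Γ.Adj y v
    · exact Or.inr (h.no_square huv h1 h2 hu hv)
    · exact Or.inl h2
  have hpx : p ≠ x := by rintro rfl; exact hxb hpb
  have hrx : r ≠ x := by rintro rfl; exact hxb hbr.symm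
  have hpv : ¬ Γ.Adj p v := (key p hup).resolve_right hpx
  have hur : ¬ Γ.Adj u r := fun h1 => (key r h1).elim (fun h2 => h2 hrv) hrx
  have hpr : p ≠ r := by rintro rfl; exact hpv hrv
  have hur' : u ≠ r := by rintro rfl; exact h.not_adj_of_hasMidpoint hm hrv
  have hmur : ¬ Γ.HasMidpoint u r := fun h1 => h.no_pentagon hbr hub.symm h1
  refine h.succAdj_three (u := u) (a := v) (b := b) (c := r)
    (h.succAdj_of_hasMidpoint_of_middle huv hu hv hub hbv hxb)
    (h.succAdj_of_hasMidpoint_of_middle hne hup hpb hm hbv.symm hpv)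
    (h.succAdj_of_two_le hur' hur hmur ?_) hne'.symm hrv.ne.symm hbr.ne
  have : ({p, x} : Finset V) ⊆ Finset.univ.filter fun w => Γ.Adj u w ∧ Γ.HasMidpoint w r := by
    intro w
    simp only [Finset.mem_insert, Finset.mem_singleton, Finset.mem_filter, Finset.mem_univ,
      true_and]
    rintro (rfl | rfl)
    · exact ⟨hup, .intro b hpr hpb hbr⟩
    · exact ⟨hu, .intro v hrx.symm hv hrv.symm⟩
  have := Finset.card_le_card this
  rw [Finset.card_pair hpx] at this
  omega

theorem not_hasMidpoint_of_succAdj {u v : V} (huv : SuccAdj s u v) : ¬ Γ.HasMidpoint u v := by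
  intro hm
  have h1 := h.count u v hm.1
  rw [if_pos huv, if_pos hm, if_neg (h.not_adj_of_hasMidpoint hm)] at h1
  have h2 : (Finset.univ.filter fun w => Γ.Adj u w ∧ Γ.HasMidpoint w v) = ∅ := by
    ext w
    simp only [Finset.mem_filter, Finset.mem_univ, true_and, Finset.notMem_empty, iff_false]
    exact fun hw => h.no_pentagon hw.1 hm hw.2.symm
  obtain ⟨hne, x, hu, hv⟩ := id hm
  have h3 : (Finset.univ.filter fun b => Γ.HasMidpoint u b ∧ Γ.HasMidpoint b v).card ≤ d - 2 := by
    rw [← h.card_neighbors_ne_ne hne hu.symm hv]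
    apply Finset.card_le_card
    intro b
    simp only [Finset.mem_filter, Finset.mem_univ, true_and]
    exact fun hb => ⟨h.no_hexagon hne hu hv hb.1 hb.2, hb.1.1.symm, hb.2.1⟩
  have := h.two_lt
  rw [h2] at h1
  simp only [Finset.card_empty] at h1
  omega

/-- Arcs of lengths 3 and 4 make `c i` consecutive to `c (i ± 3)`. The heptagon is then closed under
`s`, hence everything, against n > 7. -/
theorem no_heptagon (c : ZMod 7 → V) (hinj : Function.Injective c)
    (hc : ∀ i, Γ.Adj (c i) (c (i + 1))) : False := by
  have ha : ∀ i j, j = i + 1 → Γ.Adj (c i) (c j) := by rintro i _ rfl; exact hc i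
  have hne : ∀ i j, i ≠ j → c i ≠ c j := fun i j h1 h2 => h1 (hinj h2)
  have hm : ∀ i j, j = i + 2 → Γ.HasMidpoint (c i) (c j) := by
    rintro i _ rfl
    exact .intro (c (i + 1)) (hne _ _ (by clear * -; revert i; decide)) (hc i) (ha _ _ (by ring))
  have hs : ∀ i, SuccAdj s (c i) (c (i + 3)) := by
    intro i
    have hm1 : Γ.HasMidpoint (c (i + 1)) (c (i + 3)) := hm _ _ (by ring)
    refine h.succAdj_of_two_le (hne _ _ (by clear * -; revert i; decide)) ?_ ?_ ?_
    · intro h1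
      exact hne (i + 1) (i + 3) (by clear * -; revert i; decide) (h.no_square
        (hne i (i + 2) (by clear * -; revert i; decide)) (hc i) (ha _ _ (by ring)) h1 (ha _ _ (by ring)).symm)
    · exact fun h1 => h.no_pentagon (hc i) h1 hm1.symm
    · have h1 : 0 < (Finset.univ.filter fun w => Γ.Adj (c i) w ∧
          Γ.HasMidpoint w (c (i + 3))).card := Finset.card_pos.2 ⟨c (i + 1), by simp [hc, hm1]⟩
      have h2 : 0 < (Finset.univ.filter fun b => Γ.HasMidpoint (c i) b ∧
          Γ.HasMidpoint b (c (i + 3))).card :=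
        Finset.card_pos.2 ⟨c (i + 5), by
          have e1 := (hm (i + 5) i (by clear * -; revert i; decide)).symm
          have e2 := (hm (i + 3) (i + 5) (by ring)).symm
          simp [e1, e2]⟩
      omega
  have huniv := h.transitive (Set.range c) ⟨_, 0, rfl⟩ (by
    rintro _ ⟨i, rfl⟩
    by_contra hc'
    have h1 := hs i
    have h2 := (hs (i - 3)).symm
    rw [sub_add_cancel] at h2
    refine h.succAdj_three (c := s (c i)) h1 h2 (Or.inl rfl) (hne _ _ (by clear * -; revert i; decide)) ?_ ?_
    · exact fun h => hc' ⟨_, h⟩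
    · exact fun h => hc' ⟨_, h⟩)
  have h7 := Fintype.card_le_of_surjective c (Set.range_eq_univ.1 huniv)
  rw [ZMod.card] at h7
  have := h.card
  omega

/-- A walk of length 3 needs a second walk between `u` and `v`: length 3 would close a hexagon,
length 4 a heptagon. -/
theorem not_step_of_succAdj {u v w : V} (huv : SuccAdj s u v) (huw : Γ.Adj u w)
    (hwv : Γ.HasMidpoint w v) : False := by
  have ha := h.not_adj_of_succAdj huv
  have hm := h.not_hasMidpoint_of_succAdj huv
  have hne := h.succAdj_ne huv
  have h1 := h.count_of_far hne ha hm
  rw [if_pos huv] at h1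
  have hle : (Finset.univ.filter fun w => Γ.Adj u w ∧ Γ.HasMidpoint w v).card ≤ 1 := by
    rw [Finset.card_le_one]
    intro w hw w' hw'
    simp only [Finset.mem_filter, Finset.mem_univ, true_and] at hw hw'
    by_contra hww
    exact ha (h.no_hexagon hww hw.1.symm hw'.1 hw.2 hw'.2.symm)
  obtain ⟨b, hb⟩ := Finset.card_pos.1
    (show 0 < (Finset.univ.filter fun b => Γ.HasMidpoint u b ∧ Γ.HasMidpoint b v).card by omega)
  simp only [Finset.mem_filter, Finset.mem_univ, true_and] at hb
  obtain ⟨hub, hbv⟩ := hb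
  obtain ⟨hwv', x, hwx, hxv⟩ := id hwv
  obtain ⟨hbv', r, hbr, hrv⟩ := id hbv
  obtain ⟨hub', p, hup, hpb⟩ := id hub
  have t : ∀ {y z}, Γ.HasMidpoint y z → ¬ Γ.Adj y z := h.not_adj_of_hasMidpoint
  have hux : u ≠ x := by rintro rfl; exact ha hxv
  have hwb : w ≠ b := by rintro rfl; exact t hub huw
  have hxb : x ≠ b := by rintro rfl; exact t hbv hxv
  have hxr : x ≠ r := by
    rintro rfl
    exact h.no_pentagon huw hub (.intro x hwb.symm hbr hwx.symm)
  have hrp : r ≠ p := by rintro rfl; exact hm (.intro r hne hup hrv)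
  have hpw : p ≠ w := by
    rintro rfl
    exact h.no_pentagon hxv (.intro p hxb hwx.symm hpb) hbv
  have hur : u ≠ r := by rintro rfl; exact ha hrv
  have hwr : w ≠ r := by rintro rfl; exact t hwv hrv
  have hxp : x ≠ p := by rintro rfl; exact h.no_triangle huw hwx hup
  have hvp : v ≠ p := by rintro rfl; exact ha hup
  have e1 := huw.ne
  have e2 := hwx.ne
  have e3 := hxv.ne
  have e4 := hrv.ne
  have e5 := hbr.ne
  have e6 := hpb.ne
  have e7 := hup.ne
  refine h.no_heptagon (![u, w, x, v, r, b, p] : Fin 7 → V) ?_ ?_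
  · have : Function.Injective (![u, w, x, v, r, b, p] : Fin 7 → V) := by
      rw [← List.nodup_ofFn]
      simp
      grind
    exact this
  · intro i
    change Fin 7 at i
    fin_cases i
    exacts [huw, hwx, hxv, hrv.symm, hbr.symm, hpb.symm, hup.symm]

/-- Only walks of length 4 remain, so there are two, with middles `b` and `b'`. These are in turn
joined by two walks of length 4, through `u` and through `v`. -/
theorem exists_opposite {u v : V} (huv : SuccAdj s u v) :
    ∃ b b', SuccAdj s b b' ∧ ∀ y, (Γ.HasMidpoint u y ∧ Γ.HasMidpoint y v) ↔ y = b ∨ y = b' := by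
  have ha := h.not_adj_of_succAdj huv
  have hm := h.not_hasMidpoint_of_succAdj huv
  have hne := h.succAdj_ne huv
  have h1 := h.count_of_far hne ha hm
  have h2 : (Finset.univ.filter fun w => Γ.Adj u w ∧ Γ.HasMidpoint w v) = ∅ := by
    ext w
    simp only [Finset.mem_filter, Finset.mem_univ, true_and, Finset.notMem_empty, iff_false]
    exact fun hw => h.not_step_of_succAdj huv hw.1 hw.2
  rw [if_pos huv, h2, Finset.card_empty] at h1
  obtain ⟨b, b', hbb, hset⟩ := Finset.card_eq_two.1 h1
  have hset' : ∀ y, (Γ.HasMidpoint u y ∧ Γ.HasMidpoint y v) ↔ y = b ∨ y = b' := fun y => by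
    simpa using Finset.ext_iff.1 hset y
  refine ⟨b, b', ?_, hset'⟩
  obtain ⟨hub, hbv⟩ := (hset' b).2 (Or.inl rfl)
  obtain ⟨hub', hbv'⟩ := (hset' b').2 (Or.inr rfl)
  refine h.succAdj_of_two_le hbb (fun h3 => h.no_pentagon h3 hub.symm hub') ?_ ?_
  · rintro ⟨_, x, hx, hx'⟩
    exact hm (.intro x hne (h.no_hexagon hbb hx hx' hub.symm hub').symm
      (h.no_hexagon hbb hx hx' hbv hbv'.symm))
  · have : ({u, v} : Finset V) ⊆
        Finset.univ.filter fun y => Γ.HasMidpoint b y ∧ Γ.HasMidpoint y b' := by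
      intro w
      simp only [Finset.mem_insert, Finset.mem_singleton, Finset.mem_filter, Finset.mem_univ,
        true_and]
      rintro (rfl | rfl)
      · exact ⟨hub.symm, hub'⟩
      · exact ⟨hbv, hbv'.symm⟩
    have := Finset.card_le_card this
    rw [Finset.card_pair hne] at this
    omega

/-- Each edge of the cycle has a unique opposite edge, so the cycle has even length. -/
theorem even_card : Even (Fintype.card V) := by
  -- A vertex `u` stands for the cycle edge from `u` to `s u`; H joins opposite edges and is a
  -- perfect matching.
  let H : SimpleGraph V :=
    { Adj := fun u w => Γ.HasMidpoint u w ∧ Γ.HasMidpoint u (s w) ∧ Γ.HasMidpoint (s u) w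
        ∧ Γ.HasMidpoint (s u) (s w)
      symm := ⟨fun _ _ h1 => ⟨h1.1.symm, h1.2.2.1.symm, h1.2.1.symm, h1.2.2.2.symm⟩⟩
      loopless := ⟨fun _ h1 => h1.1.1 rfl⟩ }
  classical
  have hdeg : ∀ u, H.degree u = 1 := by
    intro u
    obtain ⟨b, b', hbb, hb⟩ := h.exists_opposite (Or.inl rfl : SuccAdj s u (s u))
    have hH : ∀ w, H.Adj u w ↔ (w = b ∨ w = b') ∧ (s w = b ∨ s w = b') := fun w => by
      rw [← hb, ← hb]
      exact ⟨fun h1 => ⟨⟨h1.1, h1.2.2.1.symm⟩, h1.2.1, h1.2.2.2.symm⟩,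
        fun h1 => ⟨h1.1.1, h1.2.1, h1.1.2.symm, h1.2.2.symm⟩⟩
    rw [← card_neighborFinset_eq_degree, Finset.card_eq_one]
    have h1 := h.succ_ne
    have h2 := h.succ_succ_ne
    rcases hbb with rfl | rfl
    · refine ⟨b, ?_⟩
      ext w
      rw [mem_neighborFinset, hH, Finset.mem_singleton]
      grind
    · refine ⟨b', ?_⟩
      ext w
      rw [mem_neighborFinset, hH, Finset.mem_singleton]
      grind
  have := H.sum_degrees_eq_twice_card_edges
  simp only [hdeg, Finset.sum_const, Finset.card_univ, smul_eq_mul, mul_one] at this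
  exact ⟨_, this.trans (two_mul _)⟩

end CyclicDefectCount

end SimpleGraph

/-! ### From the matrix equation to walk counts. -/

section Matrices

open Matrix

theorem aeval_pathPoly_four {V : Type*} [Fintype V] [DecidableEq V] (d : ℕ) (A : Matrix V V ℤ) :
    aeval A (pathPoly d 4) = A ^ 4 + A ^ 3 - (3 * ((d : ℤ) - 1)) • A ^ 2 - (2 * ((d : ℤ) - 1)) • A
      + (((d : ℤ) - 1) ^ 2) • (1 : Matrix V V ℤ) := by
  have : pathPoly d 4 = X ^ 4 + X ^ 3 - (3 * ((d : ℤ) - 1)) • X ^ 2 - (2 * ((d : ℤ) - 1)) • X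
      + (((d : ℤ) - 1) ^ 2) • (1 : ℤ[X]) := by
    simp only [pathPoly, smul_eq_C_mul, map_mul, map_sub, map_pow, map_one, map_ofNat]
    ring
  rw [this]
  simp only [map_add, map_sub, map_pow, aeval_X, map_one, map_smul]

variable {V : Type*} [Fintype V] [DecidableEq V] {Γ : SimpleGraph V} [DecidableRel Γ.Adj]
  {d : ℕ} {B : Matrix V V ℤ} {σ : ℤ} {n : ℕ} {p : ZMod n ≃ V}

omit [DecidableEq V] in
theorem SimpleGraph.IsRegularOfDegree.adjMatrix_mulVec_one (hΓ : Γ.IsRegularOfDegree d) :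
    Γ.adjMatrix ℤ *ᵥ (1 : V → ℤ) = (d : ℤ) • 1 := by
  funext v
  simp [mulVec, dotProduct, adjMatrix_apply, ← neighborFinset_eq_filter, hΓ.degree_eq]

omit [DecidableEq V] in
theorem SimpleGraph.IsRegularOfDegree.adjMatrix_mul_ones (hΓ : Γ.IsRegularOfDegree d) :
    Γ.adjMatrix ℤ * Matrix.of (fun _ _ => 1) = Matrix.of (fun _ _ => 1) * Γ.adjMatrix ℤ := by
  ext u v
  have h1 : (Finset.univ.filter fun x => Γ.Adj u x).card = d := by
    rw [← neighborFinset_eq_filter]; exact hΓ u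
  have h2 : (Finset.univ.filter fun x => Γ.Adj x v).card = d := by
    simp only [Γ.adj_comm _ v]; rw [← neighborFinset_eq_filter]; exact hΓ v
  simp [mul_apply, adjMatrix_apply, h1, h2]

theorem adjMatrix_commute_of_quartic (hΓ : Γ.IsRegularOfDegree d) {q : ℤ} (hσ : σ = 1 ∨ σ = -1)
    (hG : Γ.adjMatrix ℤ ^ 4 + Γ.adjMatrix ℤ ^ 3 - (3 * q) • Γ.adjMatrix ℤ ^ 2
      - (2 * q) • Γ.adjMatrix ℤ + (q ^ 2) • (1 : Matrix V V ℤ)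
      = Matrix.of (fun _ _ => 1) + σ • B) :
    Γ.adjMatrix ℤ * B = B * Γ.adjMatrix ℤ := by
  have h1 : Commute (Γ.adjMatrix ℤ) (Matrix.of (fun _ _ => 1) + σ • B) := by
    rw [← hG]
    have c := Commute.refl (Γ.adjMatrix ℤ)
    exact (((((c.pow_right 4).add_right (c.pow_right 3)).sub_right
      ((c.pow_right 2).smul_right _)).sub_right (c.smul_right _)).add_right
      ((Commute.one_right _).smul_right _))
  have h2 : Commute (Γ.adjMatrix ℤ) (Matrix.of (fun _ _ => 1)) := hΓ.adjMatrix_mul_ones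
  have h3 : Commute (Γ.adjMatrix ℤ) (σ • B) := by simpa using h1.sub_right h2
  rcases hσ with rfl | rfl
  · simpa using h3.eq
  · have := h3.neg_right
    simpa using this.eq

/-- Row sums in `G_{d,4}(A) = J ± B`. -/
theorem card_of_quartic (hΓ : Γ.IsRegularOfDegree d) {q : ℤ} [Nonempty V] (hn : 3 ≤ n)
    (hB : ∀ i j, B (p i) (p j) = if i - j = 1 ∨ j - i = 1 then 1 else 0)
    (hG : Γ.adjMatrix ℤ ^ 4 + Γ.adjMatrix ℤ ^ 3 - (3 * q) • Γ.adjMatrix ℤ ^ 2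
      - (2 * q) • Γ.adjMatrix ℤ + (q ^ 2) • (1 : Matrix V V ℤ)
      = Matrix.of (fun _ _ => 1) + σ • B) :
    (d : ℤ) ^ 4 + d ^ 3 - 3 * q * d ^ 2 - 2 * q * d + q ^ 2 = Fintype.card V + 2 * σ := by
  have hA := hΓ.adjMatrix_mulVec_one
  have hpow : ∀ k : ℕ, Γ.adjMatrix ℤ ^ k *ᵥ (1 : V → ℤ) = (d : ℤ) ^ k • 1 := by
    intro k
    induction k with
    | zero => simp
    | succ k ih => rw [pow_succ, ← mulVec_mulVec, hA, mulVec_smul, ih, smul_smul, pow_succ']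
  have h1 := congrFun (congrArg (· *ᵥ (1 : V → ℤ)) hG) (p 0)
  have h2 := cycle_mulVec hn hB 1 0
  simp only [add_mulVec, sub_mulVec, smul_mulVec, hpow, hA, one_mulVec, Pi.add_apply, Pi.sub_apply,
    Pi.smul_apply, smul_eq_mul, Pi.one_apply, h2] at h1
  have h3 : ((Matrix.of (fun _ _ => 1) : Matrix V V ℤ) *ᵥ (1 : V → ℤ)) (p 0) = Fintype.card V := by
    simp [mulVec, dotProduct]
  rw [h3] at h1
  linarith

/-- For q = d - 1 the bracket A² - (q + 1) becomes the matrix of `HasMidpoint`; the off-diagonal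
entries of this identity are the field `count`. -/
theorem square_of_quartic {A S : Matrix V V ℤ} {q : ℤ}
    (hG : A ^ 4 + A ^ 3 - (3 * q) • A ^ 2 - (2 * q) • A + (q ^ 2) • (1 : Matrix V V ℤ) = S) :
    (A * A - (q + 1) • (1 : Matrix V V ℤ)) * (A * A - (q + 1) • (1 : Matrix V V ℤ))
      + (A * (A * A - (q + 1) • (1 : Matrix V V ℤ)) - q • A) + A
    = S + (q - 2) • (A * A - (q + 1) • (1 : Matrix V V ℤ)) + (q ^ 2 + q - 1) • (1 : Matrix V V ℤ) := by
  subst hG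
  have e2 : A * A = A ^ 2 := (sq A).symm
  have e3 : A * A ^ 2 = A ^ 3 := (pow_succ' A 2).symm
  have e4 : A ^ 2 * A ^ 2 = A ^ 4 := (pow_add A 2 2).symm
  simp only [mul_sub, sub_mul, mul_smul_comm, smul_mul_assoc, mul_one, one_mul, e2, e3, e4]
  module

omit [DecidableEq V] in
theorem adjMatrix_mul_self_nonneg (u v : V) : 0 ≤ (Γ.adjMatrix ℤ * Γ.adjMatrix ℤ) u v := by
  rw [mul_apply]
  refine Finset.sum_nonneg fun w _ => mul_nonneg ?_ ?_ <;>
    rw [SimpleGraph.adjMatrix_apply] <;> split_ifs <;> norm_num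

/-- If the diagonal entries of `G_{d,4}(A)` are all equal to `1`, then the graph has no triangles
and two vertices have at most one common neighbour. -/
theorem adjMatrix_of_quartic_diag (hΓ : Γ.IsRegularOfDegree d) (u : V)
    (hG : (Γ.adjMatrix ℤ ^ 4 + Γ.adjMatrix ℤ ^ 3 - (3 * ((d : ℤ) - 1)) • Γ.adjMatrix ℤ ^ 2
      - (2 * ((d : ℤ) - 1)) • Γ.adjMatrix ℤ + (((d : ℤ) - 1) ^ 2) • (1 : Matrix V V ℤ)) u u = 1) :
    (∀ w, w ≠ u → (Γ.adjMatrix ℤ * Γ.adjMatrix ℤ) u w ≤ 1) ∧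
      ∀ w, Γ.Adj u w → (Γ.adjMatrix ℤ * Γ.adjMatrix ℤ) u w = 0 := by
  set A := Γ.adjMatrix ℤ with hA
  have hsymm : ∀ v w, (A * A) v w = (A * A) w v := fun v w => by
    have : (A * A)ᵀ = A * A := by rw [transpose_mul, hA, SimpleGraph.transpose_adjMatrix]
    exact congrFun (congrFun this w) v
  have hdiag : (A * A) u u = d := by
    rw [hA, SimpleGraph.adjMatrix_mul_self_apply_self, hΓ.degree_eq]
  have h4 : (A ^ 4) u u = ∑ w, (A * A) u w * (A * A) u w := by
    rw [show A ^ 4 = A * A * (A * A) by noncomm_ring, mul_apply]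
    exact Finset.sum_congr rfl fun w _ => by rw [hsymm w u]
  have h3 : (A ^ 3) u u = ∑ w, (A * A) u w * A u w := by
    rw [show A ^ 3 = A * A * A by noncomm_ring, mul_apply]
    exact Finset.sum_congr rfl fun w _ => by
      simp only [hA, SimpleGraph.adjMatrix_apply, Γ.adj_comm w u]
  have hrow : ∑ w, (A * A) u w = (d : ℤ) ^ 2 := by
    have h1 := congrFun (congrArg (A *ᵥ ·) hΓ.adjMatrix_mulVec_one) u
    simp only [← hA, mulVec_mulVec, mulVec_smul] at h1
    rw [hA, hΓ.adjMatrix_mulVec_one, ← hA] at h1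
    simp only [mulVec, dotProduct, Pi.one_apply, mul_one, Pi.smul_apply, smul_eq_mul] at h1
    rw [h1]
    ring
  have hnn : ∀ w, 0 ≤ (A * A) u w := adjMatrix_mul_self_nonneg u
  have hnA : ∀ w, 0 ≤ A u w := fun w => by
    rw [hA, SimpleGraph.adjMatrix_apply]; split_ifs <;> norm_num
  have h0 : A u u = 0 := by simp [hA]
  simp only [Matrix.add_apply, Matrix.sub_apply, Matrix.smul_apply, smul_eq_mul, one_apply_eq, h4, h3, h0, sq A,
    hdiag] at hG
  -- The diagonal value 1 is the least possible: the excess is this sum of nonnegative terms, which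
  -- therefore all vanish.
  have hsum : ∑ w ∈ Finset.univ.erase u,
      ((A * A) u w * ((A * A) u w - 1) + (A * A) u w * A u w) = 0 := by
    have : ∀ w, (A * A) u w * ((A * A) u w - 1) + (A * A) u w * A u w
        = (A * A) u w * (A * A) u w - (A * A) u w + (A * A) u w * A u w := fun w => by ring
    have h5 := Finset.add_sum_erase Finset.univ
      (fun w => (A * A) u w * ((A * A) u w - 1) + (A * A) u w * A u w) (Finset.mem_univ u)
    simp only [hdiag, h0] at h5
    simp only [this, Finset.sum_add_distrib, Finset.sum_sub_distrib, hrow] at h5 ⊢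
    linarith
  have hterm : ∀ w, 0 ≤ (A * A) u w * ((A * A) u w - 1) := fun w => by
    rcases (hnn w).eq_or_lt with h | h
    · simp [← h]
    · exact mul_nonneg h.le (by omega)
  have hz := (Finset.sum_eq_zero_iff_of_nonneg fun w _ =>
    add_nonneg (hterm w) (mul_nonneg (hnn w) (hnA w))).1 hsum
  have hz' : ∀ w, w ≠ u → (A * A) u w * ((A * A) u w - 1) = 0 ∧ (A * A) u w * A u w = 0 := by
    intro w hw
    have := hz w (by simp [hw])
    have h1 := hterm w
    have h2 := mul_nonneg (hnn w) (hnA w)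
    constructor <;> linarith
  refine ⟨fun w hw => ?_, fun w hw => ?_⟩
  · rcases mul_eq_zero.1 (hz' w hw).1 with h | h <;> omega
  · have := (hz' w hw.ne').2
    rw [hA, SimpleGraph.adjMatrix_apply, if_pos hw, mul_one] at this
    rw [hA, this]

/-- The combinatorial content of `G_{d,4}(A) = J + B`. -/
theorem cyclicDefectCount_of_quartic (hd : 2 < d) (hΓ : Γ.IsRegularOfDegree d) (hn : 7 < n)
    (hB : ∀ i j, B (p i) (p j) = if i - j = 1 ∨ j - i = 1 then 1 else 0)
    (hG : Γ.adjMatrix ℤ ^ 4 + Γ.adjMatrix ℤ ^ 3 - (3 * ((d : ℤ) - 1)) • Γ.adjMatrix ℤ ^ 2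
      - (2 * ((d : ℤ) - 1)) • Γ.adjMatrix ℤ + (((d : ℤ) - 1) ^ 2) • (1 : Matrix V V ℤ)
      = Matrix.of (fun _ _ => 1) + B) :
    Γ.CyclicDefectCount (fun v => p (p.symm v + 1)) d := by
  have hcard : Fintype.card V = n := by
    have : NeZero n := ⟨by omega⟩
    rw [← Fintype.card_congr p, ZMod.card]
  have hne : ∀ m : ℕ, 0 < m → m < 7 → ((m : ℕ) : ZMod n) ≠ 0 := fun m h0 h1 h2 => by
    rw [ZMod.natCast_eq_zero_iff] at h2
    exact absurd (Nat.le_of_dvd h0 h2) (by omega)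
  have hB' : ∀ u v, B u v = if SimpleGraph.SuccAdj (fun v => p (p.symm v + 1)) u v then 1 else 0 := by
    intro u v
    obtain ⟨i, rfl⟩ := p.surjective u
    obtain ⟨j, rfl⟩ := p.surjective v
    rw [hB]
    apply if_congr _ rfl rfl
    simp only [SimpleGraph.SuccAdj, Equiv.symm_apply_apply, p.injective.eq_iff]
    rw [sub_eq_iff_eq_add, sub_eq_iff_eq_add, add_comm 1 i, add_comm 1 j, or_comm]
  have hdiag : ∀ u, B u u = 0 := by
    intro u
    obtain ⟨i, rfl⟩ := p.surjective u
    have : (0 : ZMod n) ≠ 1 := by simpa using (hne 1 (by norm_num) (by norm_num)).symm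
    rw [hB]
    simp [this]
  have hdeg := fun u => adjMatrix_of_quartic_diag hΓ u (by
    rw [hG]; simp [hdiag])
  have hmul : ∀ u v, (Γ.adjMatrix ℤ * Γ.adjMatrix ℤ) u v
      = (Finset.univ.filter fun w => Γ.Adj u w ∧ Γ.Adj w v).card := by
    intro u v
    simp only [mul_apply, SimpleGraph.adjMatrix_apply, ← ite_and, mul_ite, mul_one, mul_zero]
    rw [Finset.card_filter]
    push_cast
    exact Finset.sum_congr rfl fun w _ => by simp only [and_comm]
  have hT : ∀ u v, (Γ.adjMatrix ℤ * Γ.adjMatrix ℤ - (((d : ℤ) - 1) + 1) • (1 : Matrix V V ℤ)) u v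
      = if Γ.HasMidpoint u v then 1 else 0 := by
    intro u v
    rw [Matrix.sub_apply, Matrix.smul_apply]
    by_cases huv : u = v
    · subst huv
      rw [SimpleGraph.adjMatrix_mul_self_apply_self, hΓ.degree_eq, one_apply_eq,
        if_neg fun h => h.1 rfl]
      simp
    · have h1 := (hdeg u).1 v (Ne.symm huv)
      rw [one_apply_ne huv, smul_zero, sub_zero]
      rw [hmul] at h1 ⊢
      split_ifs with h
      · obtain ⟨_, w, h2⟩ := h
        have : 0 < (Finset.univ.filter fun w => Γ.Adj u w ∧ Γ.Adj w v).card :=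
          Finset.card_pos.2 ⟨w, by simpa using h2⟩
        omega
      · norm_cast
        rw [Finset.card_eq_zero, Finset.filter_eq_empty_iff]
        exact fun w _ h2 => h ⟨huv, w, h2⟩
  refine ⟨hd, hΓ, hcard ▸ hn, fun u v h => ?_, fun u h => ?_, fun u h => ?_, fun S hS hs => ?_,
    fun u v w h1 h2 h3 => ?_, fun u v w x hne h1 h2 h3 h4 => ?_, fun u v huv => ?_⟩
  · simpa using h
  · have : p.symm u + 1 = p.symm u := by rw [← p.symm_apply_apply (p.symm u + 1)]; exact congrArg _ h
    exact hne 1 (by norm_num) (by norm_num) (by push_cast; linear_combination this)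
  · simp only [Equiv.symm_apply_apply] at h
    have : p.symm u + 1 + 1 = p.symm u := by
      rw [← p.symm_apply_apply (p.symm u + 1 + 1)]; exact congrArg _ h
    exact hne 2 (by norm_num) (by norm_num) (by push_cast; linear_combination this)
  · have : NeZero n := ⟨by omega⟩
    obtain ⟨v, hv⟩ := hS
    have key : ∀ k : ℕ, p (p.symm v + k) ∈ S := by
      intro k
      induction k with
      | zero => simpa using hv
      | succ k ih => simpa [add_assoc] using hs _ ih
    ext u
    simp only [Set.mem_univ, iff_true]
    have := key (p.symm u - p.symm v).val
    rwa [ZMod.natCast_zmod_val, add_sub_cancel, Equiv.apply_symm_apply] at this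
  · have h4 := (hdeg u).2 w h3
    rw [hmul] at h4
    norm_cast at h4
    rw [Finset.card_eq_zero, Finset.filter_eq_empty_iff] at h4
    exact h4 (Finset.mem_univ v) ⟨h1, h2⟩
  · have h5 := (hdeg u).1 v hne.symm
    rw [hmul] at h5
    norm_cast at h5
    exact Finset.card_le_one.1 h5 w (by simp [h1, h2]) x (by simp [h3, h4])
  · have h1 := congrFun (congrFun (square_of_quartic hG) u) v
    simp only [Matrix.add_apply, Matrix.sub_apply _ (_ • Γ.adjMatrix ℤ), Matrix.smul_apply _ (_ - _),
      Matrix.smul_apply _ (Γ.adjMatrix ℤ), hT, mul_apply (M := _ - _), mul_apply (M := Γ.adjMatrix ℤ) (N := _ - _)] at h1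
    rw [Matrix.smul_apply, one_apply_ne huv, hB'] at h1
    simp only [SimpleGraph.adjMatrix_apply, of_apply, smul_eq_mul, mul_ite, mul_one, mul_zero,
      ← ite_and] at h1
    rw [Finset.card_filter, Finset.card_filter]
    push_cast
    simp only [and_comm] at h1 ⊢
    split_ifs at h1 ⊢ <;> linarith

end Matrices

/-! ### Parity of the order and conclusion. -/

theorem mainTheorem4 {V : Type*} [Fintype V] [DecidableEq V] (Γ : SimpleGraph V)
    [DecidableRel Γ.Adj] (d : ℕ) (hd : 3 ≤ d) :
    ¬ (Γ.diam = 4 ∧ HasCyclicDefect Γ d) ∧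
    (Odd d → ¬ (Γ.girth = 9 ∧ HasCyclicExcess Γ d)) := by
  have hcard (hΓ : Γ.IsRegularOfDegree d) [Nonempty V] : 3 ≤ Fintype.card V := by
    have := Γ.degree_lt_card_verts (Classical.arbitrary V)
    rw [hΓ.degree_eq] at this
    omega
  have hfac (x : ℤ) : x ^ 4 + x ^ 3 - 3 * (x - 1) * x ^ 2 - 2 * (x - 1) * x + (x - 1) ^ 2
      = x ^ 2 * ((x - 1) ^ 2 + 1) + 1 := by ring
  refine ⟨?_, ?_⟩
  · rintro ⟨hdiam, hΓ, B, hB, hG⟩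
    have : Nontrivial V := SimpleGraph.nontrivial_of_diam_ne_zero (G := Γ) (by omega)
    obtain ⟨p, hp⟩ := hB.exists_equiv_zmod (hcard hΓ)
    rw [hdiam, aeval_pathPoly_four] at hG
    have hG' := hG
    rw [← one_smul ℤ B] at hG'
    have hn := card_of_quartic hΓ (hcard hΓ) hp hG'
    rw [hfac] at hn
    rcases Nat.even_or_odd d with he | ho
    · have h7 : 7 < Fintype.card V := by
        zify
        have : (3 : ℤ) ≤ d := by exact_mod_cast hd
        nlinarith [sq_nonneg ((d : ℤ) - 1)]
      have := (cyclicDefectCount_of_quartic (by omega) hΓ h7 hp hG).even_card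
      have h1 : Even ((Fintype.card V : ℤ) + 2 * 1) := by
        simpa [Int.even_add] using this
      rw [← hn] at h1
      have h2 : Even ((d : ℤ) ^ 2) := by simpa [Int.even_pow] using he
      exact (Int.not_even_iff_odd.2 ((h2.mul_right _).add_one)) h1
    · refine not_four_dvd_of_quartic_eq (by omega) (Or.inl rfl) (hcard hΓ) hp
        (adjMatrix_commute_of_quartic hΓ (Or.inl rfl) hG') hG' ?_
      obtain ⟨k, rfl⟩ := ho
      zify
      -- For d = 2k + 1 this is n/4 with n = d²((d - 1)² + 1) - 1; for cyclic excess n is larger by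
      -- 4.
      refine ⟨(k : ℤ) * ((4 * k ^ 3 + 4 * k ^ 2 + 2 * k + 1) : ℤ) , ?_⟩
      push_cast at hn
      linear_combination -hn
  · rintro ho ⟨hgirth, hΓ, B, hB, hG⟩
    have : Nonempty V := by
      by_contra hV
      rw [not_nonempty_iff] at hV
      have : Γ.IsAcyclic := fun v => isEmptyElim v
      rw [← SimpleGraph.girth_eq_zero] at this
      omega
    obtain ⟨p, hp⟩ := hB.exists_equiv_zmod (hcard hΓ)
    rw [hgirth, show 9 / 2 = 4 from rfl, aeval_pathPoly_four] at hG
    rw [sub_eq_add_neg _ B, ← neg_one_smul ℤ B] at hG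
    have hn := card_of_quartic hΓ (hcard hΓ) hp hG
    rw [hfac] at hn
    refine not_four_dvd_of_quartic_eq (by omega) (Or.inr rfl) (hcard hΓ) hp
      (adjMatrix_commute_of_quartic hΓ (Or.inr rfl) hG) hG ?_
    obtain ⟨k, rfl⟩ := ho
    zify
    refine ⟨(k : ℤ) * ((4 * k ^ 3 + 4 * k ^ 2 + 2 * k + 1) : ℤ) + 1, ?_⟩
    push_cast at hn
    linear_combination -hn
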